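/- For integers $n\ge 1$ and $p\ge 0$ let $C_n^p$ be the $p$-th power of the cycle $C_n$, i.e. the simple graph on the vertex set $\{v_1,\dots,v_n\}$ in which two distinct vertices $v_i$ and $v_j$ are adjacent if and only if $j\in\{i-p,\dots,i-1,i+1,\dots,i+p\}$ (indices modulo $n$). For $k\ge 1$ let $C_{2k}$ be the cycle on $2k$ vertices (with $C_2=K_2$), and let $G_1\square G_2$ denote the Cartesian product of graphs: its vertices are the pairs $(v_1,v_2)$, and $(v_1,v_2)$, $(u_1,u_2)$ are adjacent iff either $v_1=u_1$ and $v_2u_2$ is an edge of $G_2$, or $v_2=u_2$ and $v_1u_1$ is an edge of $G_1$. For a finite simple graph $G=(V,E)$ let $F_G=\prod_{uv\in E}(x_v-x_u)\in\mathbb R[x_v : v\in V]$ be its graph polynomial, with one factor for each edge (it is defined up to sign). The Alon–Tarsi number $\mathrm{AT}(G)$ is the least $k$ for which there is a monomial $\prod_v x_v^{d_v}$ with $\max_v d_v=k-1$ whose coefficient in $F_G$ is non-zero. The list chromatic number $\mathrm{ch}(G)$ is the least $m$ such that for all lists (finite sets of real numbers) $A_v$, $v\in V$, with $|A_v|\ge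 m$ one can choose colors $a_v\in A_v$ with $a_u\neq a_v$ for every edge $uv\in E$. **Proposition.** Suppose that $p+1$ divides $n$ or $n\ge p(p+1)$. Then $$\mathrm{ch}(C_n^p\square C_{2k})\le \mathrm{AT}(C_n^p\square C_{2k})\le p+2 .$$ -/

import Mathlib

namespace SimpleGraph

open MvPolynomial

/-- The `p`-th power of the cycle on the `n` vertices `0, …, n - 1`: distinct `i` and `j` are
adjacent iff `j ≡ i + d` or `j ≡ i - d` modulo `n` for some `1 ≤ d ≤ p`. -/
def cyclePower (n p : ℕ) : SimpleGraph (Fin n) where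
  Adj i j := i ≠ j ∧ ∃ d : ℕ, 1 ≤ d ∧ d ≤ p ∧
    ((i : ℕ) + d ≡ j [MOD n] ∨ (j : ℕ) + d ≡ i [MOD n])
  symm := ⟨fun _ _ h => ⟨h.1.symm, h.2.imp fun _ hd => ⟨hd.1, hd.2.1, hd.2.2.symm⟩⟩⟩
  loopless := ⟨fun _ h => h.1 rfl⟩

open Classical in
/-- The product of the factors `x_v - x_u` over all edges `uv`, where the edge `e` is directed
from `(o e).1` to `(o e).2`. -/
noncomputable def orientedGraphPolynomial {V : Type*} [Fintype V] (G : SimpleGraph V)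
    (o : Sym2 V → V × V) : MvPolynomial V ℝ :=
  ∏ e ∈ G.edgeFinset, (X (o e).2 - X (o e).1)

/-- The graph polynomial `F_G = ∏_{uv ∈ E} (x_v - x_u)`, each edge contributing one factor.
It is defined up to sign; here every edge is given an arbitrary but fixed direction. -/
noncomputable def graphPolynomial {V : Type*} [Fintype V] (G : SimpleGraph V) : MvPolynomial V ℝ :=
  G.orientedGraphPolynomial Quot.out

/-- Up to sign, the graph polynomial does not depend on how the edges are directed. -/
theorem graphPolynomial_eq_or_eq_neg {V : Type*} [Fintype V] (G : SimpleGraph V)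
    (o : Sym2 V → V × V)
    (ho : ∀ e, Sym2.mk (o e).1 (o e).2 = e) :
    G.graphPolynomial = G.orientedGraphPolynomial o ∨
      G.graphPolynomial = -G.orientedGraphPolynomial o := by
  classical
  unfold graphPolynomial orientedGraphPolynomial
  induction G.edgeFinset using Finset.induction_on with
  | empty => simp
  | insert e s he ih =>
    rw [Finset.prod_insert he, Finset.prod_insert he]
    have h1 : Sym2.mk (Quot.out e).1 (Quot.out e).2 = Sym2.mk (o e).1 (o e).2 :=
      (Quot.out_eq e).trans (ho e).symm
    rcases Sym2.eq_iff.1 h1 with ⟨h2, h3⟩ | ⟨h2, h3⟩ <;> rw [h2, h3] <;>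
      rcases ih with ih | ih <;> rw [ih]
    · exact Or.inl rfl
    · exact Or.inr (by ring)
    · exact Or.inr (by ring)
    · exact Or.inl (by ring)

/-- The Alon-Tarsi number: the least `k` such that some monomial with largest exponent `k - 1`
has a non-zero coefficient in the graph polynomial. -/
noncomputable def alonTarsiNumber {V : Type*} [Fintype V] (G : SimpleGraph V) : ℕ∞ :=
  ⨅ k ∈ {k : ℕ | ∃ d : V →₀ ℕ, Finset.univ.sup d + 1 = k ∧ coeff d G.graphPolynomial ≠ 0},
    (k : ℕ∞)

/-- `G` is `m`-choosable: whenever every vertex has a list of at least `m` colors (real numbers),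
there is a proper coloring in which every vertex gets a color from its own list. -/
def Choosable {V : Type*} (G : SimpleGraph V) (m : ℕ) : Prop :=
  ∀ L : V → Finset ℝ, (∀ v, m ≤ (L v).card) → ∃ c : G.Coloring ℝ, ∀ v, c v ∈ L v

/-- The list chromatic number: the least `m` such that `G` is `m`-choosable. -/
noncomputable def listChromaticNumber {V : Type*} (G : SimpleGraph V) : ℕ∞ :=
  ⨅ m ∈ {m : ℕ | G.Choosable m}, (m : ℕ∞)

end SimpleGraph

namespace SimpleGraph

open MvPolynomial

/-! Replace the product graph by a multigraph with one arc for each shift along either cycle factor.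
Its difference product is a multiple of the graph polynomial, so any monomial of it with exponents
at most `p + 1` dominates a monomial of the graph polynomial. This bounds the Alon–Tarsi number by
`p + 2`; the Combinatorial Nullstellensatz gives the bound for the list chromatic number.

The monomial used has every exponent equal to `p + 1`. Choosing an endpoint for each edge between
consecutive layers turns its coefficient into the trace of `N ^ (2k)`, where `N` is a transfer
matrix indexed by subsets of one layer. Reversing all arcs of a layer gives `Nᵀ = ± N`, so the trace
is, up to sign, the sum of squares of the entries of `N ^ k`, and it is non-zero as soon as `N ≠ 0`.
This is where the evenness of the second cycle enters.

Finally `N ≠ 0` if the polynomial of the cycle power has a monomial with exponents in `[p - 1, p +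
1]`. Inserting `p + 1` consecutive vertices of exponent `p` into the cycle leaves coefficients
unchanged, by a determinant identity (`coeff_windowPoly_add`). Starting from `p + 1` vertices, where
the polynomial is a squared Vandermonde product up to sign, this settles `p + 1 ∣ n`. Otherwise
write `n = r(p + 2) + m(p + 1)`: on `r(p + 2)` vertices apply the divisible case to the power `p +
1` and discard the longest arcs, then insert `m` blocks. -/

/-! ### Difference products, the Nullstellensatz and divisibility -/

/-- A product of differences of variables over a finite index set: the graph polynomial of a
multigraph whose edge `e` is directed from `t e` to `h e`. -/
noncomputable def diffProd {V E : Type*} [Fintype E] (h t : E → V) : MvPolynomial V ℝ :=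
  ∏ e, (X (h e) - X (t e))

theorem diffProd_isHomogeneous {V E : Type*} [Fintype E] (h t : E → V) :
    (diffProd h t).IsHomogeneous (Fintype.card E) := by
  have := IsHomogeneous.prod Finset.univ (fun e : E => (X (h e) - X (t e) : MvPolynomial V ℝ))
    (fun _ => 1) (fun e _ => (isHomogeneous_X ℝ _).sub (isHomogeneous_X ℝ _))
  simpa [diffProd] using this

theorem graphPolynomial_isHomogeneous {V : Type*} [Fintype V] (G : SimpleGraph V) :
    ∃ n, G.graphPolynomial.IsHomogeneous n := by
  classical
  exact ⟨_, IsHomogeneous.prod _ _ (fun _ => 1)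
    (fun e _ => (isHomogeneous_X ℝ _).sub (isHomogeneous_X ℝ _))⟩

theorem choosable_of_coeff_ne_zero {V : Type*} [Fintype V] (G : SimpleGraph V) (d : V →₀ ℕ)
    (hd : coeff d G.graphPolynomial ≠ 0) : G.Choosable (Finset.univ.sup d + 1) := by
  classical
  intro L hL
  obtain ⟨n, hn⟩ := G.graphPolynomial_isHomogeneous
  have h0 : G.graphPolynomial ≠ 0 := fun h => hd (by simp [h])
  have hdeg : G.graphPolynomial.totalDegree = d.degree := by
    rw [hn.totalDegree h0, Finsupp.degree_eq_weight_one]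
    exact (hn hd).symm
  obtain ⟨s, hs, hs'⟩ := combinatorial_nullstellensatz_exists_eval_nonzero G.graphPolynomial d hd
    hdeg L (fun i => lt_of_lt_of_le
      (Nat.lt_succ_of_le (Finset.le_sup (f := d) (Finset.mem_univ i))) (hL i))
  refine ⟨Coloring.mk s ?_, hs⟩
  intro u v huv heq
  apply hs'
  rw [graphPolynomial, orientedGraphPolynomial, map_prod]
  refine Finset.prod_eq_zero (i := s(u, v)) (by simpa using huv) ?_
  have h1 : Sym2.mk (Quot.out s(u, v)).1 (Quot.out s(u, v)).2 = s(u, v) := Quot.out_eq _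
  rcases Sym2.eq_iff.1 h1 with ⟨h2, h3⟩ | ⟨h2, h3⟩ <;> simp [h2, h3, heq]

theorem listChromaticNumber_le_alonTarsiNumber {V : Type*} [Fintype V] (G : SimpleGraph V) :
    G.listChromaticNumber ≤ G.alonTarsiNumber := by
  refine le_iInf₂ ?_
  rintro k ⟨d, rfl, hd⟩
  exact iInf₂_le _ (choosable_of_coeff_ne_zero G d hd)

/-- Choosing one arc over each edge is injective, and the direction of an arc only changes a sign.
Parallel and superfluous arcs merely enlarge the multiple. -/
theorem graphPolynomial_dvd_diffProd {V E : Type*} [Fintype V] [Fintype E] (G : SimpleGraph V)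
    (h t : E → V) (hG : ∀ u v, G.Adj u v → ∃ e, s(h e, t e) = s(u, v)) :
    G.graphPolynomial ∣ diffProd h t := by
  classical
  have hG' : ∀ z ∈ G.edgeFinset, ∃ e, s(h e, t e) = z := by
    intro z
    induction z using Sym2.ind with
    | _ u v => intro hz; exact hG u v (by simpa using hz)
  rcases isEmpty_or_nonempty E with hE | hE
  · have : G.edgeFinset = ∅ := Finset.eq_empty_of_forall_notMem fun z hz => hE.elim (hG' z hz).choose
    simp [graphPolynomial, orientedGraphPolynomial, this]
  choose! φ hφ using hG'
  have hinj : Set.InjOn φ G.edgeFinset := by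
    intro a ha b hb hab
    rw [← hφ a ha, ← hφ b hb, hab]
  have h1 : G.graphPolynomial ∣ ∏ e ∈ G.edgeFinset.image φ, (X (h e) - X (t e)) := by
    rw [Finset.prod_image hinj]
    refine Finset.prod_dvd_prod_of_dvd _ _ fun z hz => ?_
    have h1 : Sym2.mk (Quot.out z).1 (Quot.out z).2 = s(h (φ z), t (φ z)) :=
      (Quot.out_eq z).trans (hφ z hz).symm
    rcases Sym2.eq_iff.1 h1 with ⟨h2, h3⟩ | ⟨h2, h3⟩
    · rw [h2, h3, ← neg_sub, neg_dvd]
    · rw [h2, h3]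
  exact h1.trans (Finset.prod_dvd_prod_of_subset _ _ _ (Finset.subset_univ _))

theorem exists_coeff_ne_zero_of_dvd {V : Type*} {F Φ : MvPolynomial V ℝ} (hF : F ∣ Φ)
    {D : V →₀ ℕ} (hD : coeff D Φ ≠ 0) : ∃ d ≤ D, coeff d F ≠ 0 := by
  classical
  obtain ⟨Q, rfl⟩ := hF
  rw [coeff_mul] at hD
  obtain ⟨x, hx, hne⟩ := Finset.exists_ne_zero_of_sum_ne_zero hD
  exact ⟨x.1, Finset.HasAntidiagonal.mem_antidiagonal.1 hx ▸ le_self_add, left_ne_zero_of_mul hne⟩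

theorem alonTarsiNumber_le_of_dvd {V : Type*} [Fintype V] (G : SimpleGraph V)
    {Φ : MvPolynomial V ℝ} (hΦ : G.graphPolynomial ∣ Φ) {D : V →₀ ℕ} (hD : coeff D Φ ≠ 0)
    {m : ℕ} (hm : ∀ v, D v ≤ m) : G.alonTarsiNumber ≤ ((m + 1 : ℕ) : ℕ∞) := by
  obtain ⟨d, hd, hne⟩ := exists_coeff_ne_zero_of_dvd hΦ hD
  refine (iInf₂_le _ ⟨d, rfl, hne⟩).trans ?_
  have : Finset.univ.sup d ≤ m := Finset.sup_le fun v _ => (hd v).trans (hm v)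
  exact_mod_cast Nat.succ_le_succ this

/-! ### Traces of even powers and closed walks -/

section Trace

open Matrix

/-- Since `(N ^ k)ᵀ * N ^ k = ε ^ k • N ^ (2 * k)`, a vanishing trace forces `N ^ k = 0`. The same
identity shows by repeated squaring that `N` is not nilpotent. -/
theorem trace_pow_two_mul_ne_zero {α : Type*} [Fintype α] [DecidableEq α] {N : Matrix α α ℝ}
    {ε : ℝ} (hN : Nᵀ = ε • N) (h0 : N ≠ 0) (k : ℕ) : (N ^ (2 * k)).trace ≠ 0 := by
  have hpow (j : ℕ) : (N ^ j)ᵀ = ε ^ j • N ^ j := by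
    rw [transpose_pow, hN, smul_pow]
  have key (j : ℕ) : (N ^ j)ᴴ * N ^ j = ε ^ j • N ^ (2 * j) := by
    rw [conjTranspose_eq_transpose_of_trivial, hpow, smul_mul_assoc, ← pow_add, two_mul]
  have h2 (j : ℕ) : N ^ (2 ^ j) ≠ 0 := by
    induction j with
    | zero => simpa using h0
    | succ j ih =>
      intro h
      have := key (2 ^ j)
      rw [← pow_succ', h, smul_zero] at this
      exact ih (conjTranspose_mul_self_eq_zero.1 this)
  have hk : N ^ k ≠ 0 := fun h => h2 k (pow_eq_zero_of_le Nat.lt_two_pow_self.le h)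
  intro h
  apply hk
  rw [← trace_conjTranspose_mul_self_eq_zero_iff, key, trace_smul, h, smul_zero]

/-- The closing step has its own matrix `K` so that the induction can remove the first vertex of the
walk and absorb it by replacing `K` with `K * N`. -/
theorem sum_closed_walks_eq_trace {α R : Type*} [Fintype α] [DecidableEq α] [CommRing R]
    (N K : Matrix α α R) (l : ℕ) :
    ∑ s : Fin (l + 1) → α, (∏ t : Fin l, N (s t.castSucc) (s t.succ)) * K (s (Fin.last l)) (s 0) =
      (N ^ l * K).trace := by
  induction l generalizing K with
  | zero =>
    rw [← (Equiv.funUnique (Fin 1) α).symm.sum_comp]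
    simp [trace]
  | succ l ih =>
    rw [← (Fin.consEquiv fun _ => α).sum_comp, Fintype.sum_prod_type, Finset.sum_comm]
    have h1 : (N ^ (l + 1) * K).trace = (N ^ l * (K * N)).trace := by
      rw [pow_succ', mul_assoc, trace_mul_comm, mul_assoc]
    rw [h1, ← ih]
    refine Finset.sum_congr rfl fun s _ => ?_
    rw [mul_apply, Finset.mul_sum]
    refine Finset.sum_congr rfl fun a _ => ?_
    rw [Fin.prod_univ_succ]
    simp only [Fin.consEquiv_apply, Fin.castSucc_zero, Fin.cons_zero, Fin.cons_succ,
      ← Fin.succ_castSucc, ← Fin.succ_last]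
    ring

theorem sum_cyclic_eq_trace {α R : Type*} [Fintype α] [DecidableEq α] [CommRing R]
    (N : Matrix α α R) (l : ℕ) :
    ∑ s : Fin (l + 1) → α, ∏ t, N (s t) (s (t + 1)) = (N ^ (l + 1)).trace := by
  rw [pow_succ, ← sum_closed_walks_eq_trace]
  refine Finset.sum_congr rfl fun s _ => ?_
  rw [Fin.prod_univ_castSucc]
  simp

end Trace

/-! ### The transfer matrix of the product with a cycle -/

/-- Different layers involve disjoint sets of variables, so coefficients multiply. -/
theorem coeff_prod_rename {V T R : Type*} [Fintype V] [Fintype T] [CommRing R]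
    (Q : T → MvPolynomial V R) (D : V × T →₀ ℕ) :
    coeff D (∏ t, rename (fun v => (v, t)) (Q t)) =
      ∏ t, coeff (Finsupp.equivFunOnFinite.symm fun v => D (v, t)) (Q t) := by
  classical
  have h1 (t : T) : rename (fun v => (v, t)) (Q t) =
      ∑ d ∈ (Q t).support, monomial (d.mapDomain fun v => (v, t)) (coeff d (Q t)) := by
    conv_lhs => rw [(Q t).as_sum, map_sum]
    simp only [rename_monomial]
  have h2 (δ : T → V →₀ ℕ) (v : V) (t : T) :
      (∑ t, (δ t).mapDomain fun v => (v, t)) (v, t) = δ t v := by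
    rw [Finsupp.finsetSum_apply, Finset.sum_eq_single t]
    · exact Finsupp.mapDomain_apply (Prod.mk_left_injective t) _ _
    · intro b _ hb
      refine Finsupp.mapDomain_of_notMem_range _ _ ?_
      rintro ⟨w, hw⟩
      exact hb (Prod.ext_iff.1 hw).2
    · simp
  simp only [h1, Finset.prod_univ_sum]
  rw [coeff_sum]
  set δ₀ : T → V →₀ ℕ := fun t => Finsupp.equivFunOnFinite.symm fun v => D (v, t) with hδ₀
  have h3 (δ : T → V →₀ ℕ) : coeff D (∏ t, monomial ((δ t).mapDomain fun v => (v, t))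
      (coeff (δ t) (Q t))) = if δ = δ₀ then ∏ t, coeff (δ₀ t) (Q t) else 0 := by
    rw [← monomial_sum_prod, coeff_monomial]
    have h4 : (∑ t, (δ t).mapDomain fun v => (v, t)) = D ↔ δ = δ₀ := by
      constructor
      · rintro rfl
        funext t
        ext v
        simp [hδ₀, h2]
      · rintro rfl
        ext ⟨v, t⟩
        rw [h2]
        simp [hδ₀]
    by_cases h5 : δ = δ₀
    · rw [if_pos (h4.2 h5), if_pos h5, h5]
    · rw [if_neg (fun h => h5 (h4.1 h)), if_neg h5]
  simp only [h3]
  rw [Finset.sum_ite_eq', ite_eq_left_iff, Fintype.mem_piFinset]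
  intro h
  push Not at h
  obtain ⟨t, ht⟩ := h
  exact (Finset.prod_eq_zero (Finset.mem_univ t) (notMem_support_iff.1 ht)).symm

theorem diffProd_eq_sum {V E : Type*} [Fintype E] [DecidableEq E] (h t : E → V) :
    diffProd h t = ∑ s : E → Bool, monomial (∑ i, Finsupp.single (if s i then h i else t i) 1)
      (∏ i, if s i then (1 : ℝ) else -1) := by
  have h1 (i : E) : (X (h i) - X (t i) : MvPolynomial V ℝ) = ∑ b : Bool,
      monomial (Finsupp.single (if b then h i else t i) 1) (if b then (1 : ℝ) else -1) := by
    simp [X, sub_eq_add_neg]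
  simp only [diffProd, h1, Finset.prod_univ_sum, Fintype.piFinset_univ]
  exact Finset.sum_congr rfl fun s _ => (monomial_sum_prod _ _ _).symm

/-- Expand over all choices of an endpoint for each arc. Swapping every choice complements the
exponent within the total degree vector and contributes one sign per arc. -/
theorem coeff_diffProd_mul_monomial_reverse {V E : Type*} [Fintype E] (h t : E → V)
    {D D' e e' : V →₀ ℕ}
    (hD : D + D' = ∑ i, (Finsupp.single (h i) 1 + Finsupp.single (t i) 1) + e + e') :
    coeff D' (diffProd h t * monomial e' 1) =
      (-1) ^ Fintype.card E * coeff D (diffProd h t * monomial e 1) := by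
  classical
  have h1 (f d : V →₀ ℕ) : coeff d (diffProd h t * monomial f 1) = ∑ s : E → Bool,
      if ∑ i, Finsupp.single (if s i then h i else t i) 1 + f = d then
        ∏ i, (if s i then (1 : ℝ) else -1) else 0 := by
    rw [diffProd_eq_sum, Finset.sum_mul, coeff_sum]
    simp only [monomial_mul, coeff_monomial, mul_one]
  rw [h1, h1, Finset.mul_sum]
  let neg : (E → Bool) ≃ (E → Bool) := Equiv.arrowCongr (Equiv.refl E) Equiv.boolNot
  rw [← neg.sum_comp]
  refine Finset.sum_congr rfl fun s _ => ?_
  have hneg (i : E) : neg s i = !(s i) := rfl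
  have h2 : ∑ i, Finsupp.single (if neg s i then h i else t i) 1 +
      ∑ i, Finsupp.single (if s i then h i else t i) 1 =
      ∑ i, (Finsupp.single (h i) 1 + Finsupp.single (t i) 1) := by
    rw [← Finset.sum_add_distrib]
    refine Finset.sum_congr rfl fun i _ => ?_
    rw [hneg]
    cases s i <;> simp [add_comm]
  have h3 : ∏ i, (if neg s i then (1 : ℝ) else -1) =
      (-1) ^ Fintype.card E * ∏ i, (if s i then (1 : ℝ) else -1) := by
    rw [← Finset.card_univ, ← Finset.prod_const, ← Finset.prod_mul_distrib]
    refine Finset.prod_congr rfl fun i _ => ?_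
    rw [hneg]
    cases s i <;> simp
  rw [← h2] at hD
  generalize ∑ i, Finsupp.single (if neg s i then h i else t i) 1 = a at *
  generalize ∑ i, Finsupp.single (if s i then h i else t i) 1 = b at *
  have h4 : a + e' = D' ↔ b + e = D := by
    have h5 : D + D' = (b + e) + (a + e') := by rw [hD]; abel
    constructor
    · rintro rfl
      exact (add_right_cancel h5).symm
    · rintro rfl
      exact (add_left_cancel h5).symm
  simp only [h4, h3]
  split_ifs <;> simp

/-- The exponent vector with constant value `m`. -/
noncomputable def constExp (V : Type*) [Fintype V] (m : ℕ) : V →₀ ℕ :=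
  Finsupp.equivFunOnFinite.symm fun _ => m

@[simp]
theorem constExp_apply {V : Type*} [Fintype V] (m : ℕ) (v : V) : constExp V m v = m := rfl

/-- The exponent vector of the squarefree monomial with support `S`. -/
noncomputable def boolExp {V : Type*} [Fintype V] (S : V → Bool) : V →₀ ℕ :=
  Finsupp.equivFunOnFinite.symm fun v => if S v then 1 else 0

@[simp]
theorem boolExp_apply {V : Type*} [Fintype V] (S : V → Bool) (v : V) :
    boolExp S v = if S v then 1 else 0 := rfl

theorem prod_ite_X_eq_monomial {V R : Type*} [Fintype V] [CommRing R] (S : V → Bool) :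
    ∏ v, (if S v then X v else 1) = (monomial (boolExp S) 1 : MvPolynomial V R) := by
  rw [monomial_eq, C_1, one_mul, Finsupp.prod_fintype _ _ (by simp)]
  refine Finset.prod_congr rfl fun v _ => ?_
  cases h : S v <;> simp [h]

theorem prod_ite_neg_X_eq_monomial {V R : Type*} [Fintype V] [CommRing R] (S : V → Bool) :
    ∏ v, (if S v then 1 else -X v) =
      (monomial (boolExp fun v => !S v) (∏ v, if S v then 1 else -1) : MvPolynomial V R) := by
  rw [monomial_eq, Finsupp.prod_fintype _ _ (by simp), map_prod, ← Finset.prod_mul_distrib]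
  refine Finset.prod_congr rfl fun v _ => ?_
  cases h : S v <;> simp [h]

/-- The sign `(-1) ^ |Sᶜ|`. -/
noncomputable def boolSign {V : Type*} [Fintype V] (S : V → Bool) : ℝ :=
  ∏ v, if S v then 1 else -1

theorem boolSign_eq_pow {V : Type*} [Fintype V] (S : V → Bool) :
    boolSign S = (-1) ^ (boolExp fun v => !S v).degree := by
  rw [Finsupp.degree_eq_sum, ← Finset.prod_pow_eq_pow_sum]
  refine Finset.prod_congr rfl fun v _ => ?_
  cases h : S v <;> simp [h]

/-- The entries record how the part of the product graph lying over one vertex of the cycle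
interacts with the two neighbouring layers. -/
noncomputable def transferMatrix {V E : Type*} [Fintype V] [Fintype E] (h t : E → V) (p : ℕ) :
    Matrix (V → Bool) (V → Bool) ℝ :=
  .of fun S T => coeff (constExp V (p + 1))
    (diffProd h t * monomial (boolExp S + boolExp fun v => !T v) 1) * boolSign T

section

variable {V E : Type*} [Fintype V] [Fintype E] {h t : E → V} {p : ℕ}

theorem card_eq_of_regular
    (hreg : ∑ i, (Finsupp.single (h i) 1 + Finsupp.single (t i) 1) = constExp V (2 * p)) :
    Fintype.card E = Fintype.card V * p := by
  have := congrArg Finsupp.degree hreg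
  simp only [map_sum, map_add, Finsupp.degree_single] at this
  rw [Finsupp.degree_eq_sum] at this
  simp at this
  linarith

/-- Exchanging `S` and `T` corresponds to reversing all arcs. The factors `boolSign S` and `boolSign
T` agree wherever the coefficient is non-zero, because homogeneity then forces `S` and `T` to have
equal size. -/
theorem transferMatrix_transpose
    (hreg : ∑ i, (Finsupp.single (h i) 1 + Finsupp.single (t i) 1) = constExp V (2 * p)) :
    (transferMatrix h t p).transpose = ((-1 : ℝ) ^ Fintype.card E) • transferMatrix h t p := by
  ext S T
  simp only [transferMatrix, Matrix.transpose_apply, Matrix.of_apply, Matrix.smul_apply,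
    smul_eq_mul]
  rw [coeff_diffProd_mul_monomial_reverse h t (D := constExp V (p + 1))
    (e := boolExp S + boolExp fun v => !T v), mul_assoc]
  · by_cases hne : coeff (constExp V (p + 1))
      (diffProd h t * monomial (boolExp S + boolExp fun v => !T v) 1) = 0
    · simp [hne]
    · have hhom := (diffProd_isHomogeneous h t).mul
        (isHomogeneous_monomial (1 : ℝ) (d := boolExp S + boolExp fun v => !T v) rfl)
      have h1 : (constExp V (p + 1)).degree =
          Fintype.card E + (boolExp S + boolExp fun v => !T v).degree := by
        exact (DFunLike.congr_fun (Finsupp.degree_eq_weight_one (R := ℕ)) _).trans (hhom hne)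
      rw [card_eq_of_regular hreg, map_add] at h1
      have h2 : (constExp V (p + 1)).degree = Fintype.card V * (p + 1) := by
        simp [Finsupp.degree_eq_sum]
      have h3 : (boolExp S).degree + (boolExp fun v => !S v).degree = Fintype.card V := by
        rw [Finsupp.degree_eq_sum, Finsupp.degree_eq_sum, ← Finset.sum_add_distrib,
          ← Finset.card_univ, Finset.card_eq_sum_ones]
        refine Finset.sum_congr rfl fun v _ => ?_
        cases hv : S v <;> simp [hv]
      rw [boolSign_eq_pow, boolSign_eq_pow]
      congr 3
      rw [h2] at h1
      linarith
  · rw [hreg]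
    ext v
    cases hS : S v <;> cases hT : T v <;> simp [hS, hT] <;> ring

theorem transferMatrix_ne_zero {d : V →₀ ℕ} (hd : coeff d (diffProd h t) ≠ 0)
    (h1 : ∀ v, p ≤ d v + 1) (h2 : ∀ v, d v ≤ p + 1) : transferMatrix h t p ≠ 0 := by
  intro h0
  -- This entry supplies the missing exponent `p + 1 - d v`: both layer edges at `v` contribute if
  -- `d v = p - 1`, only the incoming one if `d v = p`, neither if `d v = p + 1`.
  have := congrFun (congrFun h0 fun v => decide (d v ≤ p)) fun v => decide (p ≤ d v)
  simp only [transferMatrix, Matrix.of_apply, Matrix.zero_apply] at this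
  have hexp : constExp V (p + 1) = d + ((boolExp fun v => decide (d v ≤ p)) +
      boolExp fun v => !decide (p ≤ d v)) := by
    ext v
    have := h1 v
    have := h2 v
    simp only [constExp_apply, Finsupp.add_apply, boolExp_apply, decide_eq_true_eq,
      Bool.not_eq_true', decide_eq_false_iff_not]
    split_ifs <;> omega
  rw [hexp, coeff_mul_monomial, mul_one, boolSign_eq_pow] at this
  exact mul_ne_zero hd (pow_ne_zero _ (by norm_num)) this

/-- Let `s τ v` say whether the edge from `(v, τ)` to `(v, τ + 1)` selects its upper endpoint. For
fixed `s`, the part in layer `τ` depends only on `s (τ - 1)` and `s τ`, and its coefficient is the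
corresponding entry of the transfer matrix. Summing over `s` runs over closed walks. -/
theorem coeff_cyclic_product [DecidableEq V] (l : ℕ) :
    coeff (constExp (V × Fin (l + 1)) (p + 1))
      ((∏ τ : Fin (l + 1), rename (fun v => (v, τ)) (diffProd h t)) *
        ∏ τ : Fin (l + 1), ∏ v : V, (X (v, τ + 1) - X (v, τ))) =
      (transferMatrix h t p ^ (l + 1)).trace := by
  rw [← sum_cyclic_eq_trace]
  have h1 (v : V) (τ : Fin (l + 1)) : (X (v, τ + 1) - X (v, τ) : MvPolynomial (V × Fin (l + 1)) ℝ) =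
      ∑ b : Bool, (if b then X (v, τ + 1) else 1) * (if b then 1 else -X (v, τ)) := by
    simp [sub_eq_add_neg]
  simp only [h1, Finset.prod_univ_sum, Fintype.piFinset_univ]
  rw [Finset.mul_sum, coeff_sum]
  refine Finset.sum_congr rfl fun s _ => ?_
  let Q (τ : Fin (l + 1)) : MvPolynomial V ℝ := diffProd h t *
    (monomial (boolExp (s (τ - 1))) 1 * monomial (boolExp fun v => !s τ v) (boolSign (s τ)))
  have h2 : (∏ τ : Fin (l + 1), rename (fun v => (v, τ)) (diffProd h t)) *
      ∏ τ : Fin (l + 1), ∏ v : V, ((if s τ v then X (v, τ + 1) else 1) *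
        (if s τ v then 1 else -X (v, τ))) = ∏ τ, rename (fun v => (v, τ)) (Q τ) := by
    simp only [Q, map_mul, Finset.prod_mul_distrib]
    congr 2
    · rw [← Equiv.prod_comp (Equiv.addRight (1 : Fin (l + 1)))
        fun τ => rename (fun v => (v, τ)) (monomial (boolExp (s (τ - 1))) 1)]
      refine Finset.prod_congr rfl fun τ _ => ?_
      rw [← prod_ite_X_eq_monomial, map_prod]
      refine Finset.prod_congr rfl fun v _ => ?_
      simp only [Equiv.coe_addRight, add_sub_cancel_right]
      split_ifs <;> simp
    · refine Finset.prod_congr rfl fun τ _ => ?_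
      rw [boolSign, ← prod_ite_neg_X_eq_monomial, map_prod]
      refine Finset.prod_congr rfl fun v _ => ?_
      split_ifs <;> simp
  rw [h2, coeff_prod_rename, ← Equiv.prod_comp (Equiv.addRight (1 : Fin (l + 1)))]
  refine Finset.prod_congr rfl fun τ _ => ?_
  have h3 : (Finsupp.equivFunOnFinite.symm fun v => constExp (V × Fin (l + 1)) (p + 1)
      (v, (Equiv.addRight (1 : Fin (l + 1))) τ)) = constExp V (p + 1) := rfl
  rw [h3, transferMatrix, Matrix.of_apply]
  simp only [Q, Equiv.coe_addRight, add_sub_cancel_right, monomial_mul, one_mul]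
  have h4 (a : V →₀ ℕ) (r : ℝ) : monomial a r = C r * monomial a 1 := by simp [C_mul_monomial]
  rw [h4, mul_left_comm, coeff_C_mul, mul_comm]

end

/-- If the multigraph with arcs `t e → h e` is `2p`-regular and its graph polynomial has a monomial
with all exponents between `p - 1` and `p + 1`, then its product with an even cycle has the
balanced monomial. -/
theorem coeff_diffProd_evenCycle_ne_zero {V E : Type*} [Fintype V] [Fintype E] {h t : E → V} {p : ℕ}
    (hreg : ∑ i, (Finsupp.single (h i) 1 + Finsupp.single (t i) 1) = constExp V (2 * p))
    {d : V →₀ ℕ} (hd : coeff d (diffProd h t) ≠ 0)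
    (h1 : ∀ v, p ≤ d v + 1) (h2 : ∀ v, d v ≤ p + 1) (k l : ℕ) (hl : l + 1 = 2 * k) :
    coeff (constExp (V × Fin (l + 1)) (p + 1)) (diffProd
      (Sum.elim (fun x : E × Fin (l + 1) => (h x.1, x.2)) fun x : V × Fin (l + 1) => (x.1, x.2 + 1))
      (Sum.elim (fun x => (t x.1, x.2)) fun x => (x.1, x.2))) ≠ 0 := by
  classical
  have h3 : diffProd
      (Sum.elim (fun x : E × Fin (l + 1) => (h x.1, x.2)) fun x : V × Fin (l + 1) => (x.1, x.2 + 1))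
      (Sum.elim (fun x => (t x.1, x.2)) fun x => (x.1, x.2)) =
      (∏ τ : Fin (l + 1), rename (fun v => (v, τ)) (diffProd h t)) *
        ∏ τ : Fin (l + 1), ∏ v : V, (X (v, τ + 1) - X (v, τ)) := by
    simp only [diffProd, Fintype.prod_sum_type, Sum.elim_inl, Sum.elim_inr, map_prod, map_sub,
      rename_X, Fintype.prod_prod_type_right]
  rw [h3, coeff_cyclic_product, hl]
  exact trace_pow_two_mul_ne_zero (transferMatrix_transpose hreg) (transferMatrix_ne_zero hd h1 h2) k

/-! ### Determinants of split polynomials and Vandermonde coefficients -/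

section Determinant

variable {R : Type*} [CommRing R]

/-- The polynomial `(Y - a₀) ⋯ (Y - a_{p-j-1}) (b₀ - Y) ⋯ (b_{j-1} - Y)` of degree `p`. -/
noncomputable def splitPoly (a b : ℕ → R) (p j : ℕ) : Polynomial R :=
  (∏ i ∈ Finset.range (p - j), (Polynomial.X - Polynomial.C (a i))) *
    ∏ i ∈ Finset.range j, (Polynomial.C (b i) - Polynomial.X)

theorem splitPoly_natDegree_le (a b : ℕ → R) {p j : ℕ} (hj : j ≤ p) :
    (splitPoly a b p j).natDegree ≤ p := by
  refine Polynomial.natDegree_mul_le.trans ?_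
  have h1 : (∏ i ∈ Finset.range (p - j), (Polynomial.X - Polynomial.C (a i))).natDegree ≤ p - j := by
    refine (Polynomial.natDegree_prod_le _ _).trans ?_
    refine (Finset.sum_le_card_nsmul _ _ 1 fun i _ => Polynomial.natDegree_X_sub_C_le _).trans ?_
    simp
  have h2 : (∏ i ∈ Finset.range j, (Polynomial.C (b i) - Polynomial.X)).natDegree ≤ j := by
    refine (Polynomial.natDegree_prod_le _ _).trans ?_
    refine (Finset.sum_le_card_nsmul _ _ 1 fun i _ => ?_).trans (by simp)
    rw [← Polynomial.natDegree_neg, neg_sub]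
    exact Polynomial.natDegree_X_sub_C_le _
  omega

theorem splitPoly_succ_add (a b : ℕ → R) {p j : ℕ} (hj : j ≤ p) :
    splitPoly a b (p + 1) (j + 1) + splitPoly a b (p + 1) j =
      Polynomial.C (b j - a (p - j)) * splitPoly a b p j := by
  have h1 : p + 1 - j = p - j + 1 := by omega
  simp only [splitPoly, Nat.add_sub_add_right, h1, Finset.prod_range_succ, map_sub]
  ring

/-- Adding to each row its predecessor makes every row after the first a scalar multiple of a row
for `p`, by `splitPoly_succ_add`. Column `0` holds the leading coefficients, so it vanishes below
its top entry `1`; expanding along it gives the induction. -/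
theorem det_coeff_splitPoly (a b : ℕ → R) (p : ℕ) :
    (Matrix.of fun j k : Fin (p + 1) => (splitPoly a b p j).coeff (p - k)).det =
      ∏ q ∈ Finset.range p, ∏ j ∈ Finset.range (q + 1), (b j - a (q - j)) := by
  induction p with
  | zero => simp [splitPoly]
  | succ p ih =>
    let B : Matrix (Fin (p + 2)) (Fin (p + 2)) R := Matrix.of fun i k =>
      Fin.cases ((splitPoly a b (p + 1) 0).coeff (p + 1 - k))
        (fun i => (b i - a (p - i)) * (splitPoly a b p i).coeff (p + 1 - k)) i
    rw [Matrix.det_eq_of_forall_row_eq_smul_add_pred (B := B) (fun _ => -1) (fun j => by simp [B])]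
    · rw [Matrix.det_succ_column_zero, Fin.sum_univ_succ, Finset.sum_eq_zero, add_zero,
        Finset.prod_range_succ, ← ih]
      · have h1 : B 0 0 = 1 := by
          have hd : (splitPoly a b (p + 1) 0).coeff (p + 1) = 1 := by
            simpa [splitPoly] using
              Polynomial.coeff_prod_of_natDegree_le (Finset.range (p + 1))
                (fun i => Polynomial.X - Polynomial.C (a i)) 1
                (fun i _ => Polynomial.natDegree_X_sub_C_le _)
          simpa [B] using hd
        have h2 : B.submatrix (Fin.succAbove 0) Fin.succ = Matrix.of fun i k : Fin (p + 1) =>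
            (b i - a (p - i)) *
              (Matrix.of fun j k : Fin (p + 1) => (splitPoly a b p j).coeff (p - k)) i k := by
          ext i k
          simp [B]
        rw [h1, h2, Matrix.det_mul_column, Finset.prod_range]
        simp
        ring
      · intro i _
        have : B i.succ 0 = 0 := by
          simp only [B, Matrix.of_apply, Fin.cases_succ, Fin.val_zero, Nat.sub_zero]
          rw [Polynomial.coeff_eq_zero_of_natDegree_lt, mul_zero]
          exact Nat.lt_succ_of_le (splitPoly_natDegree_le a b (Nat.lt_succ_iff.1 i.2))
        simp [this]
    · intro i k
      have := congrArg (fun f => f.coeff (p + 1 - k)) (splitPoly_succ_add a b (Nat.lt_succ_iff.1 i.2))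
      simp only [Polynomial.coeff_add, Polynomial.coeff_C_mul] at this
      simp only [B, Matrix.of_apply, Fin.cases_succ, Fin.val_succ, Fin.val_castSucc, ← this]
      ring

theorem coeff_prod_aeval_X {J : Type*} [Fintype J] (Q : J → Polynomial R) (D : J →₀ ℕ) :
    coeff D (∏ j, Polynomial.aeval (X j : MvPolynomial J R) (Q j)) = ∏ j, (Q j).coeff (D j) := by
  classical
  have h1 (j : J) : Polynomial.aeval (X j : MvPolynomial J R) (Q j) =
      ∑ k ∈ (Q j).support, monomial (Finsupp.single j k) ((Q j).coeff k) := by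
    rw [Polynomial.aeval_def, Polynomial.eval₂_eq_sum, Polynomial.sum]
    refine Finset.sum_congr rfl fun k _ => ?_
    rw [monomial_eq]
    simp [algebraMap_eq]
  have h2 (δ : J → ℕ) : ∑ j, Finsupp.single j (δ j) = D ↔ δ = D := by
    rw [DFunLike.ext_iff, funext_iff]
    refine forall_congr' fun j => ?_
    rw [Finsupp.finsetSum_apply, Finset.sum_eq_single j (by intros; simp_all) (by simp)]
    simp
  simp only [h1, Finset.prod_univ_sum]
  rw [coeff_sum]
  have h3 (δ : J → ℕ) : coeff D (∏ j, monomial (Finsupp.single j (δ j)) ((Q j).coeff (δ j))) =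
      if δ = D then ∏ j, (Q j).coeff (D j) else 0 := by
    rw [← monomial_sum_prod, coeff_monomial]
    by_cases h5 : δ = D
    · rw [if_pos ((h2 δ).2 h5), if_pos h5, h5]
    · rw [if_neg (fun h => h5 ((h2 δ).1 h)), if_neg h5]
  simp only [h3]
  rw [Finset.sum_ite_eq', ite_eq_left_iff, Fintype.mem_piFinset]
  intro h
  push Not at h
  obtain ⟨j, hj⟩ := h
  exact (Finset.prod_eq_zero (Finset.mem_univ j) (Polynomial.notMem_support_iff.1 hj)).symm

theorem prod_X_sub_X_eq_sum (p : ℕ) :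
    (∏ i : Fin (p + 1), ∏ j ∈ Finset.Ioi i, (X j - X i) : MvPolynomial (Fin (p + 1)) R) =
      ∑ σ : Equiv.Perm (Fin (p + 1)), ((Equiv.Perm.sign σ : ℤ) : MvPolynomial (Fin (p + 1)) R) *
        ∏ i, X i ^ (σ i : ℕ) := by
  rw [← Matrix.det_vandermonde, ← Matrix.det_transpose, Matrix.det_apply']
  rfl

/-- Expand the Vandermonde product over permutations. The term of `σ` contributes `X j ^ σ j`,
leaving the coefficient of degree `p - σ j` to be taken from `G j`. -/
theorem coeff_vandermonde_mul_prod_aeval {p : ℕ} (G : Fin (p + 1) → Polynomial R) :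
    coeff (constExp (Fin (p + 1)) p) ((∏ i : Fin (p + 1), ∏ j ∈ Finset.Ioi i, (X j - X i)) *
      ∏ j, Polynomial.aeval (X j : MvPolynomial (Fin (p + 1)) R) (G j)) =
      (Matrix.of fun j k : Fin (p + 1) => (G j).coeff (p - k)).det := by
  rw [prod_X_sub_X_eq_sum, Finset.sum_mul, coeff_sum, ← Matrix.det_transpose, Matrix.det_apply']
  refine Finset.sum_congr rfl fun σ _ => ?_
  have h1 : (∏ i, X i ^ (σ i : ℕ)) * ∏ j, Polynomial.aeval (X j : MvPolynomial (Fin (p + 1)) R) (G j) =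
      ∏ j, Polynomial.aeval (X j : MvPolynomial (Fin (p + 1)) R) (Polynomial.X ^ (σ j : ℕ) * G j) := by
    rw [← Finset.prod_mul_distrib]
    simp
  have h2 : ((Equiv.Perm.sign σ : ℤ) : MvPolynomial (Fin (p + 1)) R) =
      C ((Equiv.Perm.sign σ : ℤ) : R) := by simp
  rw [mul_assoc, h1, h2, coeff_C_mul, coeff_prod_aeval_X]
  congr 1
  refine Finset.prod_congr rfl fun j _ => ?_
  rw [Polynomial.coeff_X_pow_mul', constExp_apply, if_pos (Nat.lt_succ_iff.1 (σ j).2)]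
  rfl

/-- Expand one factor over `τ`. The other factor then gives the determinant of the permutation
matrix of `Fin.revPerm * τ`, and the two signs of `τ` cancel. All `(p + 1)!` terms therefore equal
the sign of the reversal, so nothing cancels. -/
theorem coeff_vandermonde_sq (p : ℕ) :
    coeff (constExp (Fin (p + 1)) p) ((∏ i : Fin (p + 1), ∏ j ∈ Finset.Ioi i, (X j - X i)) *
      ∏ i : Fin (p + 1), ∏ j ∈ Finset.Ioi i, (X j - X i) : MvPolynomial (Fin (p + 1)) ℝ) ≠ 0 := by
  nth_rw 2 [prod_X_sub_X_eq_sum]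
  rw [Finset.mul_sum, coeff_sum]
  have h1 (τ : Equiv.Perm (Fin (p + 1))) : coeff (constExp (Fin (p + 1)) p)
      ((∏ i : Fin (p + 1), ∏ j ∈ Finset.Ioi i, (X j - X i)) *
        (((Equiv.Perm.sign τ : ℤ) : MvPolynomial (Fin (p + 1)) ℝ) * ∏ i, X i ^ (τ i : ℕ))) =
      ((Equiv.Perm.sign (Fin.revPerm : Equiv.Perm (Fin (p + 1))) : ℤ) : ℝ) := by
    have h2 : ((Equiv.Perm.sign τ : ℤ) : MvPolynomial (Fin (p + 1)) ℝ) =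
        C ((Equiv.Perm.sign τ : ℤ) : ℝ) := by simp
    have h3 : ∏ i, (X i : MvPolynomial (Fin (p + 1)) ℝ) ^ (τ i : ℕ) =
        ∏ i, Polynomial.aeval (X i : MvPolynomial (Fin (p + 1)) ℝ)
          (Polynomial.X ^ (τ i : ℕ) : Polynomial ℝ) := by simp
    have h4 : (Matrix.of fun j k : Fin (p + 1) =>
        (Polynomial.X ^ (τ j : ℕ) : Polynomial ℝ).coeff (p - k)) =
        (Equiv.toPEquiv (Fin.revPerm * τ)).toMatrix := by
      ext j k
      rw [Matrix.of_apply, Polynomial.coeff_X_pow, PEquiv.toMatrix_apply]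
      refine if_congr ?_ rfl rfl
      have := (τ j).2
      have := k.2
      simp [Fin.ext_iff, Fin.val_rev]
      omega
    rw [h2, mul_left_comm, coeff_C_mul, h3, coeff_vandermonde_mul_prod_aeval, h4,
      Matrix.det_permutation, Equiv.Perm.sign_mul]
    push_cast
    rw [mul_left_comm, ← Int.cast_mul, Int.units_coe_mul_self]
    simp
  simp only [h1]
  rw [Finset.sum_const, nsmul_eq_mul]
  refine mul_ne_zero (by simp [Finset.card_univ, Fintype.card_perm, Nat.factorial_ne_zero]) ?_
  simp

end Determinant

/-! ### Inserting a block of vertices into a cycle power -/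

section Window

variable {R S : Type*} [CommRing R] [CommRing S]

/-- The factors of the product of differences along the `p`-th power of the cycle on `0, …, n - 1`
that do not cross the cut between `n - 1` and `0`. -/
def innerProd (p n : ℕ) (z : ℕ → R) : R :=
  ∏ i ∈ Finset.range n, ∏ j ∈ Finset.range n, if i < j ∧ j ≤ i + p then z j - z i else 1

/-- The factors of the product of differences along the `p`-th power of the cycle on `0, …, n - 1`
that cross the cut between `n - 1` and `0`. -/
def crossProd (p n : ℕ) (z : ℕ → R) : R :=
  ∏ i ∈ Finset.range n, ∏ j ∈ Finset.range n, if j + n ≤ i + p then z j - z i else 1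

/-- The product of differences along the `p`-th power of the cycle on `0, …, n - 1`. -/
def windowProd (p n : ℕ) (z : ℕ → R) : R :=
  innerProd p n z * crossProd p n z

theorem map_windowProd (f : R →+* S) (p n : ℕ) (z : ℕ → R) :
    f (windowProd p n z) = windowProd p n fun i => f (z i) := by
  simp only [windowProd, innerProd, crossProd, map_mul, map_prod, apply_ite f, map_sub, map_one]

theorem map_innerProd (f : R →+* S) (p n : ℕ) (z : ℕ → R) :
    f (innerProd p n z) = innerProd p n fun i => f (z i) := by
  simp only [innerProd, map_prod, apply_ite f, map_sub, map_one]

theorem innerProd_congr {p n : ℕ} {z w : ℕ → R} (h : ∀ i < n, z i = w i) :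
    innerProd p n z = innerProd p n w := by
  unfold innerProd
  refine Finset.prod_congr rfl fun i hi => Finset.prod_congr rfl fun j hj => ?_
  rw [h i (Finset.mem_range.1 hi), h j (Finset.mem_range.1 hj)]

theorem prod_range_ite_lt {M : Type*} [CommMonoid M] {m n : ℕ} (h : m ≤ n) (f : ℕ → M) :
    (∏ i ∈ Finset.range n, if i < m then f i else 1) = ∏ i ∈ Finset.range m, f i := by
  rw [← Finset.prod_filter]
  congr 1
  ext i
  simp only [Finset.mem_filter, Finset.mem_range]
  omega

theorem prod_range_ite_gt {M : Type*} [CommMonoid M] {m n : ℕ} (f : ℕ → M) :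
    (∏ i ∈ Finset.range n, if n ≤ i + m then f i else 1) =
      ∏ i ∈ Finset.range n, if i < m then f (n - 1 - i) else 1 := by
  rw [← Finset.prod_range_reflect]
  refine Finset.prod_congr rfl fun i hi => ?_
  have := Finset.mem_range.1 hi
  refine if_congr ?_ rfl rfl
  omega

theorem prod_range_add_prod_range_add {M : Type*} [CommMonoid M] (n m : ℕ) (f : ℕ → ℕ → M) :
    (∏ i ∈ Finset.range (n + m), ∏ j ∈ Finset.range (n + m), f i j) =
      (∏ i ∈ Finset.range n, ∏ j ∈ Finset.range n, f i j) *
        (∏ j ∈ Finset.range m, ∏ i ∈ Finset.range n, f i (n + j)) *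
        ((∏ i ∈ Finset.range m, ∏ j ∈ Finset.range n, f (n + i) j) *
          ∏ i ∈ Finset.range m, ∏ j ∈ Finset.range m, f (n + i) (n + j)) := by
  rw [Finset.prod_comm (s := Finset.range m) (t := Finset.range n)]
  simp only [Finset.prod_range_add, Finset.prod_mul_distrib]
  exact mul_mul_mul_comm _ _ _ _

/-- A gap of `p + 1` new vertices is too long for an old pair to be joined across it. The new
vertices form a clique, and the new vertex `n + j` is joined to the last `p - j` and the first `j`
old ones. -/
theorem windowProd_add {p n : ℕ} (h : p ≤ n) (z : ℕ → R) :
    windowProd p (n + (p + 1)) z = innerProd p n z *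
      ((∏ i ∈ Finset.range (p + 1), ∏ j ∈ Finset.range (p + 1),
          if i < j then z (n + j) - z (n + i) else 1) *
        ∏ j ∈ Finset.range (p + 1),
          ((∏ i ∈ Finset.range n, if n ≤ i + (p - j) then z (n + j) - z i else 1) *
            ∏ i ∈ Finset.range n, if i < j then z i - z (n + j) else 1)) := by
  have e1 : innerProd p (n + (p + 1)) z = innerProd p n z *
      (∏ j ∈ Finset.range (p + 1), ∏ i ∈ Finset.range n,
        if n ≤ i + (p - j) then z (n + j) - z i else 1) *
      (1 * ∏ i ∈ Finset.range (p + 1), ∏ j ∈ Finset.range (p + 1),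
          if i < j then z (n + j) - z (n + i) else 1) := by
    rw [innerProd, prod_range_add_prod_range_add]
    refine congrArg₂ _ (congrArg₂ _ rfl ?_) (congrArg₂ _ ?_ ?_)
    · refine Finset.prod_congr rfl fun i hi => Finset.prod_congr rfl fun j hj => ?_
      have := Finset.mem_range.1 hi
      have := Finset.mem_range.1 hj
      exact if_congr (by omega) rfl rfl
    · refine Finset.prod_eq_one fun i _ => Finset.prod_eq_one fun j hj => ?_
      have := Finset.mem_range.1 hj
      rw [if_neg (by omega)]
    · refine Finset.prod_congr rfl fun i hi => Finset.prod_congr rfl fun j hj => ?_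
      have := Finset.mem_range.1 hi
      have := Finset.mem_range.1 hj
      exact if_congr (by omega) rfl rfl
  have e2 : crossProd p (n + (p + 1)) z = 1 * 1 * ((∏ j ∈ Finset.range (p + 1),
      ∏ i ∈ Finset.range n, if i < j then z i - z (n + j) else 1) * 1) := by
    rw [crossProd, prod_range_add_prod_range_add]
    refine congrArg₂ _ (congrArg₂ _ ?_ ?_) (congrArg₂ _ ?_ ?_)
    · refine Finset.prod_eq_one fun i hi => Finset.prod_eq_one fun j hj => ?_
      have := Finset.mem_range.1 hi
      rw [if_neg (by omega)]
    · refine Finset.prod_eq_one fun i hi => Finset.prod_eq_one fun j hj => ?_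
      have := Finset.mem_range.1 hj
      rw [if_neg (by omega)]
    · refine Finset.prod_congr rfl fun i hi => Finset.prod_congr rfl fun j hj => ?_
      exact if_congr (by omega) rfl rfl
    · refine Finset.prod_eq_one fun i hi => Finset.prod_eq_one fun j hj => ?_
      have := Finset.mem_range.1 hi
      rw [if_neg (by omega)]
  rw [windowProd, e1, e2]
  simp only [Finset.prod_mul_distrib]
  ring

/-- Grouping the crossing pairs by `q`, the sum of their distances to the two sides of the cut,
matches the product form of `det_coeff_splitPoly`. -/
theorem crossProd_eq {p n : ℕ} (h : p ≤ n) (z : ℕ → R) :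
    crossProd p n z = ∏ q ∈ Finset.range p, ∏ j ∈ Finset.range (q + 1),
      (z j - z (n - 1 - (q - j))) := by
  have h1 : crossProd p n z = ∏ j ∈ Finset.range p, ∏ i ∈ Finset.range (p - j),
      (z j - z (n - 1 - i)) := by
    rw [crossProd, Finset.prod_comm, ← prod_range_ite_lt h]
    refine Finset.prod_congr rfl fun j hj => ?_
    split_ifs with hjp
    · rw [← prod_range_ite_lt (show p - j ≤ n by omega),
        ← prod_range_ite_gt fun i => z j - z i]
      exact Finset.prod_congr rfl fun i hi => if_congr (by omega) rfl rfl
    · refine Finset.prod_eq_one fun i hi => ?_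
      have := Finset.mem_range.1 hi
      rw [if_neg (by omega)]
  rw [h1, Finset.prod_sigma', Finset.prod_sigma']
  refine Finset.prod_bij' (fun x _ => ⟨x.1 + x.2, x.1⟩) (fun x _ => ⟨x.2, x.1 - x.2⟩)
    ?_ ?_ ?_ ?_ ?_
  · rintro ⟨a, b⟩ hx
    simp only [Finset.mem_sigma, Finset.mem_range] at hx ⊢
    omega
  · rintro ⟨a, b⟩ hx
    simp only [Finset.mem_sigma, Finset.mem_range] at hx ⊢
    omega
  · rintro ⟨a, b⟩ hx
    simp
  · rintro ⟨a, b⟩ hx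
    simp only [Finset.mem_sigma, Finset.mem_range] at hx
    simp only [Sigma.mk.injEq, heq_eq_eq, and_true]
    omega
  · rintro ⟨a, b⟩ hx
    simp

theorem prod_ite_lt_eq_prod_Ioi {M : Type*} [CommMonoid M] (m : ℕ) (f : ℕ → ℕ → M) :
    (∏ i ∈ Finset.range m, ∏ j ∈ Finset.range m, if i < j then f i j else 1) =
      ∏ i : Fin m, ∏ j ∈ Finset.Ioi i, f i j := by
  rw [Finset.prod_range]
  refine Finset.prod_congr rfl fun i _ => ?_
  rw [Finset.prod_range, ← Finset.prod_filter]
  congr 1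
  ext j
  simp

/-- The clique of new vertices is a Vandermonde product and their edges to old vertices are split
polynomials. The resulting determinant is exactly the product of the crossing differences that the
insertion destroyed. -/
theorem coeff_windowProd_add {p n : ℕ} (h : p ≤ n) (x : ℕ → R)
    (z : ℕ → MvPolynomial (Fin (p + 1)) R) (hzx : ∀ i < n, z i = C (x i))
    (hzX : ∀ j : Fin (p + 1), z (n + j) = X j) :
    coeff (constExp (Fin (p + 1)) p) (windowProd p (n + (p + 1)) z) = windowProd p n x := by
  have h1 : innerProd p n z = C (innerProd p n x) := by
    rw [map_innerProd]
    exact innerProd_congr hzx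
  have h2 : (∏ i ∈ Finset.range (p + 1), ∏ j ∈ Finset.range (p + 1),
      if i < j then z (n + j) - z (n + i) else 1) =
      ∏ i : Fin (p + 1), ∏ j ∈ Finset.Ioi i, (X j - X i) := by
    rw [prod_ite_lt_eq_prod_Ioi (p + 1) fun i j => z (n + j) - z (n + i)]
    simp only [hzX]
  have h3 : (∏ j ∈ Finset.range (p + 1),
      ((∏ i ∈ Finset.range n, if n ≤ i + (p - j) then z (n + j) - z i else 1) *
        ∏ i ∈ Finset.range n, if i < j then z i - z (n + j) else 1)) =
      ∏ j : Fin (p + 1), Polynomial.aeval (X j : MvPolynomial (Fin (p + 1)) R)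
        (splitPoly (fun i => x (n - 1 - i)) x p j) := by
    rw [Finset.prod_range]
    refine Finset.prod_congr rfl fun j _ => ?_
    have hj := j.2
    rw [prod_range_ite_gt, prod_range_ite_lt (by omega), prod_range_ite_lt (by omega), splitPoly,
      map_mul, map_prod, map_prod]
    congr 1
    · refine Finset.prod_congr rfl fun i hi => ?_
      have := Finset.mem_range.1 hi
      rw [hzX, hzx _ (by omega)]
      simp [algebraMap_eq]
    · refine Finset.prod_congr rfl fun i hi => ?_
      have := Finset.mem_range.1 hi
      rw [hzX, hzx _ (by omega)]
      simp [algebraMap_eq]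
  rw [windowProd_add h, h1, h2, h3, coeff_C_mul, coeff_vandermonde_mul_prod_aeval,
    det_coeff_splitPoly, windowProd, crossProd_eq h]

theorem windowProd_eq_prod_mod {p n : ℕ} (h : p < n) (z : ℕ → R) :
    windowProd p n z =
      ∏ i ∈ Finset.range n, ∏ d ∈ Finset.range p, (z ((i + d + 1) % n) - z i) := by
  rw [windowProd, innerProd, crossProd, ← Finset.prod_mul_distrib]
  refine Finset.prod_congr rfl fun i hi => ?_
  have hi := Finset.mem_range.1 hi
  rw [← Finset.prod_filter_mul_prod_filter_not (Finset.range p) fun d => i + d + 1 < n,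
    ← Finset.prod_filter, ← Finset.prod_filter]
  congr 1
  · refine Finset.prod_bij' (fun j _ => j - i - 1) (fun d _ => i + d + 1) ?_ ?_ ?_ ?_ ?_ <;>
      intro a ha <;> simp only [Finset.mem_filter, Finset.mem_range] at ha ⊢ <;> try omega
    rw [Nat.mod_eq_of_lt (by omega), show i + (a - i - 1) + 1 = a by omega]
  · refine Finset.prod_bij' (fun j _ => j + n - i - 1) (fun d _ => i + d + 1 - n) ?_ ?_ ?_ ?_ ?_ <;>
      intro a ha <;> simp only [Finset.mem_filter, Finset.mem_range] at ha ⊢ <;> try omega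
    rw [show i + (a + n - i - 1) + 1 = a + n by omega, Nat.add_mod_right,
      Nat.mod_eq_of_lt (by omega)]

/-- With `p + 1` vertices each pair occurs twice, once in each direction. -/
theorem windowProd_self_succ (p : ℕ) (z : ℕ → R) :
    windowProd p (p + 1) z = (∏ i : Fin (p + 1), ∏ j ∈ Finset.Ioi i, (z j - z i)) *
      ∏ i : Fin (p + 1), ∏ j ∈ Finset.Ioi i, (-1 * (z j - z i)) := by
  rw [windowProd]
  congr 1
  · rw [innerProd, ← prod_ite_lt_eq_prod_Ioi (p + 1) fun i j => z j - z i]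
    refine Finset.prod_congr rfl fun i hi => Finset.prod_congr rfl fun j hj => ?_
    have := Finset.mem_range.1 hj
    exact if_congr (by omega) rfl rfl
  · rw [crossProd, Finset.prod_comm, ← prod_ite_lt_eq_prod_Ioi (p + 1) fun i j => -1 * (z j - z i)]
    refine Finset.prod_congr rfl fun i hi => Finset.prod_congr rfl fun j hj => ?_
    exact if_congr (by omega) (by ring) rfl

end Window

/-! ### Near-balanced monomials of cycle powers -/

section WindowPoly

/-- The windowed product of differences in the variables indexed by `Fin n`. -/
noncomputable def windowPoly (p n : ℕ) : MvPolynomial (Fin n) ℝ :=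
  windowProd p n fun i => if h : i < n then X ⟨i, h⟩ else 0

/-- Concatenation of exponent vectors. -/
noncomputable def appendExp {n m : ℕ} (d : Fin n →₀ ℕ) (e : Fin m →₀ ℕ) : Fin (n + m) →₀ ℕ :=
  Finsupp.equivFunOnFinite.symm (Fin.append d e)

/-- A polynomial in `n + m` variables as a polynomial in the last `m` variables. -/
noncomputable def splitVars (n m : ℕ) :
    MvPolynomial (Fin (n + m)) ℝ →+* MvPolynomial (Fin m) (MvPolynomial (Fin n) ℝ) :=
  eval₂Hom (C.comp C) (Fin.append (fun i => C (X i)) X)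

theorem coeff_coeff_splitVars {n m : ℕ} (d : Fin n →₀ ℕ) (e : Fin m →₀ ℕ)
    (F : MvPolynomial (Fin (n + m)) ℝ) :
    coeff d (coeff e (splitVars n m F)) = coeff (appendExp d e) F := by
  induction F using MvPolynomial.induction_on' with
  | add F G hF hG => simp only [map_add, coeff_add, hF, hG]
  | monomial u a =>
    let u₁ : Fin n →₀ ℕ := Finsupp.equivFunOnFinite.symm fun i => u (Fin.castAdd m i)
    let u₂ : Fin m →₀ ℕ := Finsupp.equivFunOnFinite.symm fun i => u (Fin.natAdd n i)
    have h1 : splitVars n m (monomial u a) = monomial u₂ (monomial u₁ a) := by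
      rw [splitVars, coe_eval₂Hom, eval₂_monomial, Finsupp.prod_fintype _ _ (by simp),
        Fin.prod_univ_add, monomial_eq (s := u₂), monomial_eq (s := u₁),
        Finsupp.prod_fintype _ _ (by simp), Finsupp.prod_fintype _ _ (by simp)]
      simp [u₁, u₂, mul_assoc]
    have h2 : u = appendExp d e ↔ u₂ = e ∧ u₁ = d := by
      simp only [DFunLike.ext_iff, u₁, u₂, appendExp, Finsupp.equivFunOnFinite_symm_apply_apply,
        Fin.forall_fin_add, Fin.append_left, Fin.append_right]
      exact and_comm
    classical
    rw [h1, coeff_monomial, coeff_monomial]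
    split_ifs with h3 h4 h4
    · rw [coeff_monomial, if_pos (h2.1 h4).2]
    · rw [coeff_monomial, if_neg fun h => h4 (h2.2 ⟨h3, h⟩)]
    · exact absurd (h2.1 h4).1 h3
    · rw [coeff_zero]

theorem coeff_windowPoly_add {p n : ℕ} (h : p ≤ n) (d : Fin n →₀ ℕ) :
    coeff (appendExp d (constExp (Fin (p + 1)) p)) (windowPoly p (n + (p + 1))) =
      coeff d (windowPoly p n) := by
  rw [← coeff_coeff_splitVars, windowPoly, map_windowProd]
  congr 1
  refine coeff_windowProd_add h _ _ (fun i hi => ?_) fun j => ?_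
  · have h1 : (⟨i, by omega⟩ : Fin (n + (p + 1))) = Fin.castAdd (p + 1) ⟨i, hi⟩ := rfl
    rw [dif_pos (by omega), dif_pos hi, h1, splitVars, coe_eval₂Hom, eval₂_X, Fin.append_left]
  · have h1 : (⟨n + j, by omega⟩ : Fin (n + (p + 1))) = Fin.natAdd n j := rfl
    rw [dif_pos (by omega), h1]
    simp [splitVars]

theorem appendExp_constExp (n m p : ℕ) :
    appendExp (constExp (Fin n) p) (constExp (Fin m) p) = constExp (Fin (n + m)) p := by
  ext i
  refine Fin.addCases (fun i => ?_) (fun i => ?_) i <;> simp [appendExp]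

theorem coeff_windowPoly_self_succ (p : ℕ) :
    coeff (constExp (Fin (p + 1)) p) (windowPoly p (p + 1)) ≠ 0 := by
  have h1 : windowPoly p (p + 1) = C (∏ i : Fin (p + 1), ∏ _j ∈ Finset.Ioi i, (-1 : ℝ)) *
      ((∏ i : Fin (p + 1), ∏ j ∈ Finset.Ioi i, (X j - X i)) *
        ∏ i : Fin (p + 1), ∏ j ∈ Finset.Ioi i, (X j - X i)) := by
    rw [windowPoly, windowProd_self_succ]
    simp only [Fin.is_lt, dite_true, Fin.eta, Finset.prod_mul_distrib, map_prod, map_neg, map_one]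
    ring
  rw [h1, coeff_C_mul]
  refine mul_ne_zero ?_ (coeff_vandermonde_sq p)
  exact Finset.prod_ne_zero_iff.2 fun i _ => Finset.prod_ne_zero_iff.2 fun j _ => by norm_num

theorem coeff_windowPoly_mul_ne_zero (p m : ℕ) :
    coeff (constExp (Fin (p + 1 + m * (p + 1))) p) (windowPoly p (p + 1 + m * (p + 1))) ≠ 0 := by
  induction m with
  | zero =>
    have h : p + 1 + 0 * (p + 1) = p + 1 := by ring
    rw [h]
    exact coeff_windowPoly_self_succ p
  | succ m ih =>
    have h : p + 1 + (m + 1) * (p + 1) = p + 1 + m * (p + 1) + (p + 1) := by ring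
    rw [h, ← appendExp_constExp, coeff_windowPoly_add (by omega)]
    exact ih

theorem coeff_windowPoly_ne_zero_of_dvd {p n : ℕ} (hn : 1 ≤ n) (h : p + 1 ∣ n) :
    coeff (constExp (Fin n) p) (windowPoly p n) ≠ 0 := by
  obtain ⟨m, rfl⟩ := h
  obtain ⟨m, rfl⟩ : ∃ k, m = k + 1 := Nat.exists_eq_succ_of_ne_zero (by rintro rfl; simp at hn)
  have h : (p + 1) * (m + 1) = p + 1 + m * (p + 1) := by ring
  rw [h]
  exact coeff_windowPoly_mul_ne_zero p m

/-- The head of the arc with tail `i` and length `d + 1` in the power of a cycle. -/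
def arcHead {n p : ℕ} (x : Fin n × Fin p) : Fin n :=
  ⟨(x.1 + x.2 + 1) % n, Nat.mod_lt _ x.1.pos⟩

theorem windowPoly_eq_diffProd {p n : ℕ} (h : p < n) :
    windowPoly p n = diffProd (arcHead (n := n) (p := p)) Prod.fst := by
  rw [windowPoly, windowProd_eq_prod_mod h, diffProd, Fintype.prod_prod_type, Finset.prod_range]
  refine Finset.prod_congr rfl fun i _ => ?_
  rw [Finset.prod_range]
  refine Finset.prod_congr rfl fun d _ => ?_
  rw [dif_pos i.2, dif_pos (Nat.mod_lt _ i.pos)]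
  rfl

theorem arcHead_injective {n p : ℕ} (d : Fin p) :
    Function.Injective fun i : Fin n => arcHead (i, d) := by
  intro i j hij
  simp only [arcHead, Fin.mk.injEq, add_assoc] at hij
  have := Nat.ModEq.add_right_cancel' _ hij
  rw [Nat.ModEq, Nat.mod_eq_of_lt i.2, Nat.mod_eq_of_lt j.2] at this
  exact Fin.ext this

theorem sum_single_of_bijective {V : Type*} [Fintype V] {g : V → V} (hg : Function.Bijective g) :
    ∑ i, Finsupp.single (g i) 1 = constExp V 1 := by
  classical
  rw [hg.sum_comp fun i => Finsupp.single i 1]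
  ext v
  rw [Finsupp.finsetSum_apply, Finset.sum_eq_single v (by intros; simp_all) (by simp)]
  simp

theorem arcHead_regular (n p : ℕ) :
    ∑ x : Fin n × Fin p, (Finsupp.single (arcHead x) 1 + Finsupp.single x.1 1) =
      constExp (Fin n) (2 * p) := by
  rw [Fintype.sum_prod_type_right]
  have h1 (d : Fin p) : ∑ i : Fin n,
      (Finsupp.single (arcHead (i, d)) 1 + Finsupp.single (i, d).1 1) = constExp (Fin n) 2 := by
    rw [Finset.sum_add_distrib, sum_single_of_bijective
      (Finite.injective_iff_bijective.1 (arcHead_injective d)),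
      sum_single_of_bijective (g := fun i => (i, d).1) Function.bijective_id]
    ext v
    simp
  simp only [h1]
  ext v
  simp [mul_comm]

theorem windowPoly_succ {p n : ℕ} (h : p + 1 < n) :
    windowPoly (p + 1) n =
      windowPoly p n * diffProd (fun i : Fin n => arcHead (i, Fin.last p)) id := by
  rw [windowPoly_eq_diffProd h, windowPoly_eq_diffProd (by omega), diffProd, diffProd, diffProd,
    Fintype.prod_prod_type_right, Fintype.prod_prod_type_right, Fin.prod_univ_castSucc]
  rfl

/-- Each vertex is the head of exactly one arc and the tail of exactly one. -/
theorem le_two_of_coeff_diffProd_ne_zero {V : Type*} [Fintype V] {g : V → V}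
    (hg : Function.Bijective g) {d : V →₀ ℕ} (hd : coeff d (diffProd g id) ≠ 0) (v : V) :
    d v ≤ 2 := by
  classical
  rw [diffProd_eq_sum, coeff_sum] at hd
  obtain ⟨s, -, hs⟩ := Finset.exists_ne_zero_of_sum_ne_zero hd
  rw [coeff_monomial] at hs
  have h1 := (ite_ne_right_iff.1 hs).1
  have h2 : d ≤ constExp V 2 := by
    have h3 : constExp V 2 = ∑ i, (Finsupp.single (g i) 1 + Finsupp.single (id i) 1) := by
      rw [Finset.sum_add_distrib, sum_single_of_bijective hg,
        sum_single_of_bijective Function.bijective_id]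
      ext v
      simp
    rw [h3, ← h1]
    refine Finset.sum_le_sum fun i _ => ?_
    split_ifs
    · exact le_self_add
    · exact le_add_self
  exact h2 v

/-- If `p + 1 ∣ n` or `p (p + 1) ≤ n`, the graph polynomial of the `p`-th power of the `n`-cycle
has a monomial with all exponents between `p - 1` and `p + 1`. -/
theorem exists_coeff_windowPoly_ne_zero {p n : ℕ} (hn : 1 ≤ n)
    (h : p + 1 ∣ n ∨ p * (p + 1) ≤ n) :
    ∃ d, coeff d (windowPoly p n) ≠ 0 ∧ ∀ v, p ≤ d v + 1 ∧ d v ≤ p + 1 := by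
  by_cases hdvd : p + 1 ∣ n
  · exact ⟨_, coeff_windowPoly_ne_zero_of_dvd hn hdvd, fun v => by simp⟩
  have hle := h.resolve_left hdvd
  set q := n / (p + 1) with hq
  set r := n % (p + 1) with hr
  have hr0 : r ≠ 0 := fun h0 => hdvd (Nat.dvd_of_mod_eq_zero h0)
  have hrp : r ≤ p := Nat.lt_succ_iff.1 (Nat.mod_lt _ p.succ_pos)
  have hpq : p ≤ q := (Nat.le_div_iff_mul_le p.succ_pos).2 hle
  obtain ⟨m, hm⟩ : ∃ m, q = r + m := Nat.exists_eq_add_of_le (hrp.trans hpq)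
  -- From `n = q(p + 1) + r` with `r ≤ p ≤ q`, one extra vertex is moved into each of `r` blocks.
  have hnm : n = r * (p + 1 + 1) + m * (p + 1) := by
    rw [← Nat.div_add_mod n (p + 1), ← hq, ← hr, hm]
    ring
  rw [hnm]
  have hbig : p + 1 < r * (p + 1 + 1) := by
    have := Nat.mul_le_mul_right (p + 1 + 1) (Nat.one_le_iff_ne_zero.2 hr0)
    omega
  clear_value q r
  clear hnm hm hq hr
  induction m with
  | zero =>
    rw [zero_mul, add_zero]
    -- The power `p + 1` has the monomial with all exponents `p + 1`. Removing its arcs of length `p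
    -- + 1` lowers each exponent by at most two, so some monomial for the power `p` has exponents in
    -- `[p - 1, p + 1]`.
    have h1 := coeff_windowPoly_ne_zero_of_dvd (p := p + 1) (n := r * (p + 1 + 1)) (by omega)
      (dvd_mul_left _ _)
    rw [windowPoly_succ hbig, coeff_mul] at h1
    obtain ⟨x, hx, hne⟩ := Finset.exists_ne_zero_of_sum_ne_zero h1
    refine ⟨x.1, left_ne_zero_of_mul hne, fun v => ?_⟩
    have h2 := le_two_of_coeff_diffProd_ne_zero
      (Finite.injective_iff_bijective.1 (arcHead_injective _)) (right_ne_zero_of_mul hne) v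
    have h3 := DFunLike.congr_fun (Finset.HasAntidiagonal.mem_antidiagonal.1 hx) v
    rw [Finsupp.add_apply, constExp_apply] at h3
    omega
  | succ m ih =>
    obtain ⟨d, hd, hv⟩ := ih
    have h1 : r * (p + 1 + 1) + (m + 1) * (p + 1) = r * (p + 1 + 1) + m * (p + 1) + (p + 1) := by ring
    rw [h1]
    refine ⟨appendExp d (constExp _ p), ?_, fun v => ?_⟩
    · rwa [coeff_windowPoly_add (by omega)]
    · refine Fin.addCases (fun i => ?_) (fun i => ?_) v
      · simpa [appendExp] using hv i
      · simp [appendExp]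

end WindowPoly

/-! ### Covering the edges by arcs, and the conclusion -/

theorem exists_arc_of_cyclePower_adj {n p : ℕ} {u v : Fin n} (h : (cyclePower n p).Adj u v) :
    ∃ x : Fin n × Fin p, s(arcHead x, x.1) = s(u, v) := by
  have key {u v : Fin n} {d : ℕ} (h1 : 1 ≤ d) (h2 : d ≤ p) (h3 : (u : ℕ) + d ≡ v [MOD n]) :
      arcHead (u, (⟨d - 1, by omega⟩ : Fin p)) = v := by
    ext
    rw [Nat.ModEq, Nat.mod_eq_of_lt v.2] at h3
    rw [← h3]
    simp only [arcHead]
    congr 1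
    omega
  obtain ⟨-, d, h1, h2, h3 | h3⟩ := h
  · exact ⟨(u, ⟨d - 1, by omega⟩), by rw [key h1 h2 h3, Sym2.eq_swap]⟩
  · exact ⟨(v, ⟨d - 1, by omega⟩), by rw [key h1 h2 h3]⟩

theorem exists_succ_of_cycleGraph_adj {l : ℕ} {u v : Fin (l + 1)} (h : (cycleGraph (l + 1)).Adj u v) :
    ∃ x : Fin (l + 1), s(x + 1, x) = s(u, v) := by
  rcases l with _ | l
  · exact absurd h cycleGraph_one_adj
  rcases cycleGraph_adj.1 h with h | h
  · exact ⟨v, by rw [← h, add_sub_cancel]⟩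
  · exact ⟨u, by rw [← h, add_sub_cancel, Sym2.eq_swap]⟩

end SimpleGraph

open SimpleGraph in
theorem mainTheorem7 (n p k : ℕ) (hn : 1 ≤ n) (hk : 1 ≤ k)
    (h : p + 1 ∣ n ∨ p * (p + 1) ≤ n) :
    ((SimpleGraph.cyclePower n p).boxProd (SimpleGraph.cycleGraph (2 * k))).listChromaticNumber ≤
        ((SimpleGraph.cyclePower n p).boxProd (SimpleGraph.cycleGraph (2 * k))).alonTarsiNumber ∧
      ((SimpleGraph.cyclePower n p).boxProd (SimpleGraph.cycleGraph (2 * k))).alonTarsiNumber ≤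
        ((p + 2 : ℕ) : ℕ∞) := by
  refine ⟨listChromaticNumber_le_alonTarsiNumber _, ?_⟩
  have hpn : p < n := by
    rcases h with h | h
    · exact Nat.le_of_dvd hn h
    · rcases Nat.eq_zero_or_pos p with rfl | hp
      · exact hn
      · nlinarith
  obtain ⟨d, hd, hv⟩ := exists_coeff_windowPoly_ne_zero hn h
  rw [windowPoly_eq_diffProd hpn] at hd
  obtain ⟨l, hl⟩ : ∃ l, 2 * k = l + 1 := ⟨2 * k - 1, by omega⟩
  have hne := coeff_diffProd_evenCycle_ne_zero (arcHead_regular n p) hd (fun v => (hv v).1)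
    (fun v => (hv v).2) k l hl.symm
  rw [hl]
  -- Only covering of edges by arcs is needed. For short cycles, such as `k = 1` or `n ≤ 2 * p`,
  -- several arcs may lie over one edge.
  refine alonTarsiNumber_le_of_dvd _ (graphPolynomial_dvd_diffProd _ _ _ ?_) hne fun v => le_rfl
  rintro ⟨u, a⟩ ⟨v, b⟩ huv
  rcases boxProd_adj.1 huv with ⟨h1, h2⟩ | ⟨h1, h2⟩
  · dsimp only at h1 h2
    subst h2
    obtain ⟨x, hx⟩ := exists_arc_of_cyclePower_adj h1
    exact ⟨Sum.inl (x, a), by simpa using congrArg (Sym2.map fun w => (w, a)) hx⟩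
  · dsimp only at h1 h2
    subst h2
    obtain ⟨x, hx⟩ := exists_succ_of_cycleGraph_adj h1
    exact ⟨Sum.inr (u, x), by simpa using congrArg (Sym2.map fun w => (u, w)) hx⟩
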